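/- Let $\mathcal E$ be an elementary topos (a cartesian closed category with finite limits and a subobject classifier $\Omega$), and let $j:\Omega\to\Omega$ be a local operator (Lawvere–Tierney topology) on $\mathcal E$ with $j\le\neg\neg$, i.e. such that the subobject of $\Omega$ classified by $j$ is contained in the one classified by the double negation $\neg\neg:\Omega\to\Omega$. Let $\mathbf{sh}_j(\mathcal E)$ be the full subcategory of $\mathcal E$ on the $j$-sheaves. For a subobject $A\rightarrowtail E$ in $\mathcal E$, let $\neg A\rightarrowtail E$ be its pseudocomplement in $\mathcal E$ (the greatest subobject of $E$ disjoint from $A$), and let $\neg^j$ denote pseudocomplements of subobjects in $\mathbf{sh}_j(\mathcal E)$. Then the inclusion $\mathbf{sh}_j(\mathcal E)\hookrightarrow\mathcal E$ has a left adjoint $a_j:\mathcal E\to\mathbf{sh}_j(\mathcal E)$ (the associated sheaf functor, unique up to isomorphism), $a_j$ preserves monomorphisms, and: 1. for every subobject $A\rightarrowtail E$ in $\mathcal E$, the pseudocomplement of $a_j(A)\rightarrowtail a_j(E)$ in $\mathbf{sh}_j(\mathcal E)$ exists and $a_j(\neg A)\cong\neg^j a_j(A)$ as subobjects of $a_j(E)$;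 2. in particular, if $A\rightarrowtail E$ lies in $\mathbf{sh}_j(\mathcal E)$ (that is, $A$ and $E$ are $j$-sheaves), then $\neg A$ is a $j$-sheaf, and $\neg^j A$ exists and is isomorphic to $\neg A$ as a subobject of $E$. -/

import Mathlib

open CategoryTheory CategoryTheory.Limits MonoidalCategory CartesianMonoidalCategory

universe v u

/-- `n` is the pseudocomplement of `a` in a partially ordered set: the greatest among the elements
that are disjoint from `a`, i.e. that have only the least element as a common lower bound
with `a`. -/
def IsPseudocomplement {α : Type*} [PartialOrder α] (a n : α) : Prop :=
  IsGreatest {c : α | ∀ d : α, d ≤ c → d ≤ a → IsBot d} n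

/-- The action of a functor that preserves monomorphisms on subobjects. -/
noncomputable def CategoryTheory.Functor.mapSubobject {C D : Type*} [Category* C] [Category* D]
    (F : C ⥤ D) [F.PreservesMonomorphisms] {X : C} (A : Subobject X) : Subobject (F.obj X) :=
  Subobject.mk (F.map A.arrow)

/-! An elementary topos is a category `E` with finite limits that is cartesian closed and has a
subobject classifier `true : Ω₀ ⟶ Ω` (here `Ω₀` is automatically a terminal object); it is expressed
by `[HasFiniteLimits E] [CartesianMonoidalCategory E] [MonoidalClosed E]` together with a term
of `Subobject.Classifier E`. -/

namespace Topos

section Classifier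

variable {E : Type u} [Category.{v} E] [HasFiniteLimits E] (Ω : Subobject.Classifier E)

/-- The subobject of `X` classified by a morphism `X ⟶ Ω`. -/
noncomputable def classified {X : E} (f : X ⟶ Ω.Ω) : Subobject X :=
  (Subobject.pullback f).obj (Subobject.mk Ω.truth)

theorem classified_injective {X : E} {f g : X ⟶ Ω.Ω} (h : classified Ω f = classified Ω g) :
    f = g :=
  Ω.representableBy.homEquiv.injective h

theorem classified_chi {X A : E} (m : A ⟶ X) [Mono m] : classified Ω (Ω.χ m) = Subobject.mk m :=
  Subobject.Classifier.pullback_χ_obj_mk_truth Ω m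

theorem classified_comp {X Y : E} (g : Y ⟶ X) (f : X ⟶ Ω.Ω) :
    classified Ω (g ≫ f) = (Subobject.pullback g).obj (classified Ω f) :=
  Subobject.pullback_comp g f _

theorem le_pullback_mk_iff {X : E} (t : Ω.Ω₀ ⟶ Ω.Ω) [Mono t] (f : X ⟶ Ω.Ω) (C : Subobject X) :
    C ≤ (Subobject.pullback f).obj (Subobject.mk t) ↔ C.arrow ≫ f = Ω.χ₀ _ ≫ t := by
  constructor
  · intro hC
    rw [← Subobject.ofLE_arrow hC, Category.assoc, ← (Subobject.isPullback f (Subobject.mk t)).w,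
      ← Subobject.underlyingIso_hom_comp_eq_mk]
    simp only [← Category.assoc]
    congr 1
    exact Ω.isTerminalΩ₀.hom_ext _ _
  · intro h
    exact Subobject.le_of_comm ((Subobject.isPullback f (Subobject.mk t)).lift
      (Ω.χ₀ _ ≫ (Subobject.underlyingIso t).inv) C.arrow (by simp [h])) (IsPullback.lift_snd _ _ _ _)

theorem le_classified_iff {X : E} (f : X ⟶ Ω.Ω) (C : Subobject X) :
    C ≤ classified Ω f ↔ C.arrow ≫ f = Ω.χ₀ _ ≫ Ω.truth :=
  le_pullback_mk_iff Ω Ω.truth f C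

theorem classified_truth (X : E) : classified Ω (Ω.χ₀ X ≫ Ω.truth) = ⊤ := by
  rw [classified_comp]
  have : classified Ω Ω.truth = ⊤ := Subobject.pullback_self _
  rw [this, Subobject.pullback_top]

end Classifier

section LocalOperators

variable {E : Type u} [Category.{v} E] [HasFiniteLimits E] [CartesianMonoidalCategory E]
  (Ω : Subobject.Classifier E)

instance mono_lift_truth : Mono (lift Ω.truth Ω.truth) :=
  mono_of_mono_fac (lift_fst Ω.truth Ω.truth)

/-- The conjunction `Ω × Ω ⟶ Ω`, the classifying morphism of `⟨true, true⟩`. -/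
noncomputable def and : Ω.Ω ⊗ Ω.Ω ⟶ Ω.Ω := Ω.χ (lift Ω.truth Ω.truth)

theorem classified_and {X : E} (f g : X ⟶ Ω.Ω) :
    classified Ω (lift f g ≫ and Ω) = classified Ω f ⊓ classified Ω g := by
  have key : classified Ω (and Ω) = classified Ω (fst _ _) ⊓ classified Ω (snd _ _) := by
    rw [and, classified_chi]
    apply le_antisymm
    · refine le_inf ?_ ?_ <;> rw [le_classified_iff, ← Subobject.underlyingIso_hom_comp_eq_mk,
        Category.assoc]
      · rw [lift_fst]
        congr 1
        exact Ω.isTerminalΩ₀.hom_ext _ _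
      · rw [lift_snd]
        congr 1
        exact Ω.isTerminalΩ₀.hom_ext _ _
    · refine Subobject.le_mk_of_comm (Ω.χ₀ _) ?_
      rw [comp_lift]
      apply CartesianMonoidalCategory.hom_ext
      · rw [lift_fst, (le_classified_iff Ω _ _).1 inf_le_left]
      · rw [lift_snd, (le_classified_iff Ω _ _).1 inf_le_right]
  rw [classified_comp, key, Subobject.inf_pullback, ← classified_comp, ← classified_comp,
    lift_fst, lift_snd]

/-- A local operator (Lawvere–Tierney topology). -/
structure LocalOperator where
  /-- the underlying endomorphism of `Ω` -/
  hom : Ω.Ω ⟶ Ω.Ω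
  truth_hom : Ω.truth ≫ hom = Ω.truth
  hom_hom : hom ≫ hom = hom
  and_hom : and Ω ≫ hom = (hom ⊗ₘ hom) ≫ and Ω

/-- The order of local operators: that of the subobjects of `Ω` they classify. -/
instance : LE (LocalOperator Ω) := ⟨fun j k => classified Ω j.hom ≤ classified Ω k.hom⟩

end LocalOperators

namespace LocalOperator

variable {E : Type u} [Category.{v} E] [HasFiniteLimits E] [CartesianMonoidalCategory E]
  {Ω : Subobject.Classifier E} (j : LocalOperator Ω)

/-- The `j`-closure of a subobject: it is classified by the composite of the classifying morphism
with `j`. -/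
noncomputable def closure {X : E} (A : Subobject X) : Subobject X :=
  classified Ω (Ω.χ A.arrow ≫ j.hom)

/-- A `j`-dense subobject. -/
def IsDense {X : E} (A : Subobject X) : Prop := j.closure A = ⊤

/-- The `j`-sheaves: the objects `F` such that every morphism to `F` from the domain of a `j`-dense
monomorphism extends uniquely along it. -/
def isSheaf : ObjectProperty E := fun F =>
  ∀ {X A : E} (m : A ⟶ X) [Mono m], j.IsDense (Subobject.mk m) →
    ∀ f : A ⟶ F, ∃! g : X ⟶ F, m ≫ g = f

/-- The category `sh_j(E)` of `j`-sheaves, a full subcategory of `E`. -/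
abbrev Sh : Type u := j.isSheaf.FullSubcategory

/-- The inclusion `sh_j(E) ⥤ E`. -/
abbrev inclusion : j.Sh ⥤ E := j.isSheaf.ι

instance {X Y : j.Sh} (f : X.obj ⟶ Y.obj) [Mono f] :
    Mono (ObjectProperty.homMk f : X ⟶ Y) :=
  j.inclusion.mono_of_mono_map (inferInstanceAs (Mono f))

/-- A subobject in `E` of a `j`-sheaf whose domain is a `j`-sheaf, regarded as a subobject
in `sh_j(E)`. -/
noncomputable def subobjectSh {X : j.Sh} (A : Subobject X.obj) (hA : j.isSheaf (A : E)) :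
    Subobject X :=
  Subobject.mk (ObjectProperty.homMk A.arrow : (⟨(A : E), hA⟩ : j.Sh) ⟶ X)

end LocalOperator

section Negation

variable {E : Type u} [Category.{v} E] [HasFiniteLimits E] [CartesianMonoidalCategory E]
  [MonoidalClosed E]

/-- The domain of the truth value "every truth value is true". -/
noncomputable def zero (Ω : Subobject.Classifier E) : E :=
  equalizer (MonoidalClosed.curry (fst Ω.Ω (𝟙_ E)))
    (MonoidalClosed.curry (Ω.χ₀ (Ω.Ω ⊗ 𝟙_ E) ≫ Ω.truth))

theorem eq_truth_of_hom_zero (Ω : Subobject.Classifier E) {Y : E} (g : Y ⟶ zero Ω) (φ : Y ⟶ Ω.Ω) :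
    φ = Ω.χ₀ Y ≫ Ω.truth := by
  have g' : Y ⟶ equalizer (MonoidalClosed.curry (fst Ω.Ω (𝟙_ E)))
    (MonoidalClosed.curry (Ω.χ₀ (Ω.Ω ⊗ 𝟙_ E) ≫ Ω.truth)) := g
  have h := g' ≫= equalizer.condition (MonoidalClosed.curry (fst Ω.Ω (𝟙_ E)))
    (MonoidalClosed.curry (Ω.χ₀ (Ω.Ω ⊗ 𝟙_ E) ≫ Ω.truth))
  rw [← Category.assoc, ← Category.assoc, ← MonoidalClosed.curry_natural_left,
    ← MonoidalClosed.curry_natural_left] at h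
  have h2 := lift φ (𝟙 Y) ≫= MonoidalClosed.curry_injective h
  simp only [whiskerLeft_fst, lift_fst] at h2
  rw [h2]
  simp only [← Category.assoc]
  congr 1
  exact Ω.isTerminalΩ₀.hom_ext _ _

theorem isIso_of_hom_zero (Ω : Subobject.Classifier E) {A Y : E} (g : Y ⟶ zero Ω) (m : A ⟶ Y) [Mono m] : IsIso m := by
  rw [Subobject.isIso_iff_mk_eq_top, ← classified_chi Ω, eq_truth_of_hom_zero Ω g (Ω.χ m),
    classified_truth]

theorem mono_of_hom_zero (Ω : Subobject.Classifier E) {Y Z : E} (g : Y ⟶ zero Ω) (f : Y ⟶ Z) : Mono f := by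
  have : IsIso (pullback.diagonal f) := isIso_of_hom_zero Ω (pullback.fst f f ≫ g) _
  exact (pullback.isIso_diagonal_iff f).1 this

/-- An elementary topos has an initial object. -/
theorem hasInitial (Ω : Subobject.Classifier E) : HasInitial E := by
  have h (X : E) : Unique (zero Ω ⟶ X) :=
    { default :=
        have := mono_of_hom_zero Ω (fst (zero Ω) X) (fst (zero Ω) X)
        have := isIso_of_hom_zero Ω (𝟙 _) (fst (zero Ω) X)
        inv (fst (zero Ω) X) ≫ snd _ _
      uniq := fun a => by
        have := mono_of_hom_zero Ω (fst (zero Ω) X) (fst (zero Ω) X)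
        have := isIso_of_hom_zero Ω (𝟙 _) (fst (zero Ω) X)
        rw [IsIso.eq_inv_comp]
        have h1 : IsIso (equalizer.ι (fst (zero Ω) X ≫ a) (snd _ _)) :=
          isIso_of_hom_zero Ω (fst _ _) _
        exact (cancel_epi (equalizer.ι (fst (zero Ω) X ≫ a) (snd _ _))).1
          (equalizer.condition _ _) }
  exact hasInitial_of_unique (zero Ω)

theorem initialMonoClass (Ω : Subobject.Classifier E) : InitialMonoClass E := by
  have := hasInitial Ω
  exact InitialMonoClass.of_initial fun X => by
    have : Mono (initialIsInitial.to X) :=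
      mono_of_hom_zero Ω (initial.to (zero Ω)) _
    exact this

/-- `false : 1 ⟶ Ω`, the classifying morphism of `0 ⟶ 1`. -/
noncomputable def false (Ω : Subobject.Classifier E) : Ω.Ω₀ ⟶ Ω.Ω :=
  haveI := hasInitial Ω
  haveI := initialMonoClass Ω
  Ω.χ (initial.to Ω.Ω₀)

instance (Ω : Subobject.Classifier E) : Mono (false Ω) := Ω.isTerminalΩ₀.mono_from _

/-- The negation `Ω ⟶ Ω`, the classifying morphism of `false`. -/
noncomputable def not (Ω : Subobject.Classifier E) : Ω.Ω ⟶ Ω.Ω := Ω.χ (false Ω)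

/-- The negation `¬ A` of a subobject: it is classified by the composite of the classifying
morphism with the negation of `Ω`. -/
noncomputable def neg (Ω : Subobject.Classifier E) {X : E} (A : Subobject X) : Subobject X :=
  classified Ω (Ω.χ A.arrow ≫ not Ω)

theorem isBot_classified_false (Ω : Subobject.Classifier E) (X : E) : IsBot (classified Ω (Ω.χ₀ X ≫ false Ω)) := by
  have := hasInitial Ω
  have := initialMonoClass Ω
  have h0 : Nonempty (((classified Ω (Ω.χ₀ X ≫ false Ω) : Subobject X) : E) ⟶ zero Ω) := by
    have h : classified Ω (Ω.χ₀ X ≫ false Ω) =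
        (Subobject.pullback (Ω.χ₀ X)).obj (Subobject.mk (initial.to Ω.Ω₀)) := by
      rw [classified_comp, false, classified_chi]
    rw [h]
    exact ⟨Subobject.pullbackπ _ _ ≫ (Subobject.underlyingIso _).hom ≫ initial.to _⟩
  obtain ⟨g⟩ := h0
  intro D
  have h1 := isIso_of_hom_zero Ω (Subobject.ofLE _ _ inf_le_left ≫ g)
    (𝟙 ((classified Ω (Ω.χ₀ X ≫ false Ω) ⊓ D : Subobject X) : E))
  have h2 := isIso_of_hom_zero Ω g
    (Subobject.ofLE (classified Ω (Ω.χ₀ X ≫ false Ω) ⊓ D) _ inf_le_left)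
  exact (Subobject.le_of_comm (inv (Subobject.ofLE (classified Ω (Ω.χ₀ X ≫ false Ω) ⊓ D) _
    inf_le_left)) (by simp)).trans inf_le_right

theorem neg_classified (Ω : Subobject.Classifier E) {X : E} (f : X ⟶ Ω.Ω) : neg Ω (classified Ω f) = classified Ω (f ≫ not Ω) := by
  have h : Ω.χ (classified Ω f).arrow = f := Ω.χ_pullback_obj_mk_truth_arrow f
  rw [neg, h]

theorem le_neg_iff (Ω : Subobject.Classifier E) {X : E} (A C : Subobject X) :
    C ≤ neg Ω A ↔ ∀ D : Subobject X, D ≤ C → D ≤ A → IsBot D := by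
  have hA : classified Ω (Ω.χ A.arrow) = A := by rw [classified_chi, Subobject.mk_arrow]
  have h1 : C ≤ neg Ω A ↔ C.arrow ≫ Ω.χ A.arrow = Ω.χ₀ _ ≫ false Ω := by
    rw [← le_pullback_mk_iff, neg, classified_comp, not, classified_chi]
  have h2 : C.arrow ≫ Ω.χ A.arrow = Ω.χ₀ _ ≫ false Ω ↔
      IsBot ((Subobject.pullback C.arrow).obj A) := by
    constructor
    · intro h
      have := isBot_classified_false Ω (C : E)
      rwa [← h, classified_comp, hA] at this
    · intro h
      apply classified_injective
      rw [classified_comp, hA]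
      exact le_antisymm (h _) (isBot_classified_false Ω (C : E) _)
  rw [h1, h2]
  constructor
  · intro h D hC hA' B
    have h3 : (Subobject.map C.arrow).obj ((Subobject.pullback C.arrow).obj A) ≤
      (Subobject.map C.arrow).obj ((Subobject.pullback C.arrow).obj B) :=
        (Subobject.map C.arrow).monotone (h _)
    rw [← Subobject.inf_eq_map_pullback, ← Subobject.inf_eq_map_pullback] at h3
    exact (le_inf hC hA').trans (h3.trans inf_le_right)
  · intro h B
    have h3 := h (C ⊓ A) inf_le_left inf_le_right ((Subobject.map C.arrow).obj B)
    rw [Subobject.inf_eq_map_pullback] at h3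
    have h4 := (Subobject.pullback C.arrow).monotone h3
    rwa [Subobject.pullback_map_self, Subobject.pullback_map_self] at h4

/-- The negation of a subobject is its pseudocomplement. -/
theorem isPseudocomplement_neg (Ω : Subobject.Classifier E) {X : E} (A : Subobject X) : IsPseudocomplement A (neg Ω A) :=
  ⟨(le_neg_iff Ω A _).1 le_rfl, fun _ hc => (le_neg_iff Ω A _).2 hc⟩

theorem le_neg_comm (Ω : Subobject.Classifier E) {X : E} {A C : Subobject X} :
    C ≤ neg Ω A ↔ A ≤ neg Ω C := by
  rw [le_neg_iff, le_neg_iff]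
  exact ⟨fun h D a b => h D b a, fun h D a b => h D b a⟩

theorem le_neg_neg (Ω : Subobject.Classifier E) {X : E} (A : Subobject X) :
    A ≤ neg Ω (neg Ω A) :=
  (le_neg_comm Ω).1 le_rfl

theorem neg_neg_neg (Ω : Subobject.Classifier E) {X : E} (A : Subobject X) :
    neg Ω (neg Ω (neg Ω A)) = neg Ω A :=
  le_antisymm ((le_neg_comm Ω).1 ((le_neg_neg Ω A).trans (le_neg_neg Ω _))) (le_neg_neg Ω _)

theorem neg_neg_inf (Ω : Subobject.Classifier E) {X : E} (A B : Subobject X) :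
    neg Ω (neg Ω (A ⊓ B)) = neg Ω (neg Ω A) ⊓ neg Ω (neg Ω B) := by
  have anti {C D : Subobject X} (h : C ≤ D) : neg Ω D ≤ neg Ω C :=
    (le_neg_comm Ω).1 (h.trans (le_neg_neg Ω D))
  apply le_antisymm
  · exact le_inf (anti (anti inf_le_left)) (anti (anti inf_le_right))
  · rw [le_neg_iff]
    intro e he hn
    refine (le_neg_iff Ω _ _).1 (he.trans inf_le_left) e le_rfl ((le_neg_iff Ω _ _).2 ?_)
    intro e' he' hA
    refine (le_neg_iff Ω _ _).1 ((he'.trans he).trans inf_le_right) e' le_rfl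
      ((le_neg_iff Ω _ _).2 ?_)
    intro e'' he'' hB
    exact (le_neg_iff Ω _ _).1 hn e'' (he''.trans he') (le_inf (he''.trans hA) hB)

/-- The double negation topology `¬¬`. -/
noncomputable def LocalOperator.notNot (Ω : Subobject.Classifier E) : LocalOperator Ω where
  hom := not Ω ≫ not Ω
  truth_hom := by
    apply classified_injective
    have h : classified Ω Ω.truth = ⊤ := Subobject.pullback_self _
    rw [← Category.assoc, ← neg_classified, ← neg_classified, h, eq_top_iff]
    exact le_neg_neg Ω _
  hom_hom := by
    apply classified_injective
    simp only [← Category.assoc, ← neg_classified, neg_neg_neg]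
  and_hom := by
    apply classified_injective
    have h1 : ((not Ω ≫ not Ω) ⊗ₘ (not Ω ≫ not Ω)) =
        lift (fst Ω.Ω Ω.Ω ≫ not Ω ≫ not Ω) (snd Ω.Ω Ω.Ω ≫ not Ω ≫ not Ω) := by
      apply CartesianMonoidalCategory.hom_ext <;> simp
    have h2 : and Ω = lift (fst Ω.Ω Ω.Ω) (snd Ω.Ω Ω.Ω) ≫ and Ω := by simp
    rw [h1, classified_and, h2]
    simp only [← Category.assoc, ← neg_classified]
    rw [classified_and, neg_neg_inf]

end Negation

end Topos

/-! A subobject of a sheaf is itself a sheaf exactly when it is `j`-closed, so negation in `sh_j(E)`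
agrees with that of `E` as soon as negations are closed. That is what `j ≤ ¬¬` provides: the closure
of `A` lies below `¬¬A`, and `¬¬¬A = ¬A`. In particular the empty subobject `¬⊤` is closed, so
emptiness can be checked `j`-locally.

The associated sheaf functor `a` is controlled through its unit `X ⟶ aX`, which is a cover (its
image is dense) and densely mono (elements with the same image agree on a dense subobject). Such a
map is the closed image of `x ↦ closure of {x}`, taken in the sheaf of closed subobjects of `X`
(`exists_closedImage`, `exists_associatedSheaf`). Sheaves are orthogonal to such maps
(`isSheaf.existsUnique_extension`), which gives the adjunction, and uniqueness of adjoints carries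
both properties to the unit of any left adjoint.

So elements of `aX` come locally from `X`, and equality in `aX` is local equality in `X`. Hence `a`
preserves monomorphisms (for every `j`); an element common to `a(A)` and `a(¬A)` would come locally
from both `A` and `¬A`; and an element of `¬a(A)` comes locally from `¬A`. -/

namespace Topos

/-! ### Membership of generalized elements -/

section Factors

variable {E : Type u} [Category.{v} E] [HasFiniteLimits E]

/-- `D.Factors w` plays the role of "the generalized element `w` belongs to `D`"; this form lets
closure and density, which are stable under pullback, act on membership. -/
theorem factors_iff_pullback_eq_top {X Y : E} (D : Subobject Y) (w : X ⟶ Y) :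
    D.Factors w ↔ (Subobject.pullback w).obj D = ⊤ := by
  constructor
  · intro h
    have : (Subobject.pullback w).obj D =
        (Subobject.pullback (D.factorThru w h)).obj ((Subobject.pullback D.arrow).obj D) := by
      rw [← Subobject.pullback_comp, Subobject.factorThru_arrow]
    have h' : (Subobject.pullback D.arrow).obj D = ⊤ :=
      (congrArg (Subobject.pullback D.arrow).obj (Subobject.mk_arrow D).symm).trans
        (Subobject.pullback_self D.arrow)
    rw [this, h', Subobject.pullback_top]
  · intro h
    have h1 : ((Subobject.pullback w).obj D).Factors (𝟙 X) := h ▸ Subobject.top_factors _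
    have h2 : w = (Subobject.factorThru _ _ h1 ≫ Subobject.pullbackπ w D) ≫ D.arrow := by
      rw [Category.assoc, (Subobject.isPullback w D).w, Subobject.factorThru_arrow_assoc,
        Category.id_comp]
    rw [h2]
    exact Subobject.factors_comp_arrow _

theorem pullback_factors_iff {X Y Z : E} (D : Subobject Z) (g : Y ⟶ Z) (w : X ⟶ Y) :
    ((Subobject.pullback g).obj D).Factors w ↔ D.Factors (w ≫ g) := by
  rw [factors_iff_pullback_eq_top, factors_iff_pullback_eq_top, Subobject.pullback_comp]

theorem eq_top_iff_factors_id {X : E} (D : Subobject X) : D = ⊤ ↔ D.Factors (𝟙 X) := by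
  rw [factors_iff_pullback_eq_top, Subobject.pullback_id]

omit [HasFiniteLimits E] in
theorem le_iff_factors {X : E} (A B : Subobject X) : A ≤ B ↔ B.Factors A.arrow :=
  ⟨fun h => Subobject.factors_of_le _ h (Subobject.factors_self A), Subobject.le_of_factors⟩

theorem inf_factors_iff {X Y : E} (A B : Subobject Y) (w : X ⟶ Y) :
    (A ⊓ B).Factors w ↔ A.Factors w ∧ B.Factors w := by
  simp only [factors_iff_pullback_eq_top, Subobject.inf_pullback, inf_eq_top_iff]

omit [HasFiniteLimits E] in
theorem mk_factors {X Y Z : E} (m : Z ⟶ Y) [Mono m] (w : X ⟶ Y) :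
    (Subobject.mk m).Factors w ↔ ∃ t : X ⟶ Z, t ≫ m = w := by
  constructor
  · intro h
    exact ⟨Subobject.factorThru _ w h ≫ (Subobject.underlyingIso m).hom, by simp⟩
  · rintro ⟨t, rfl⟩
    exact Subobject.factors_of_factors_right _ (Subobject.mk_factors_self m)

end Factors

/-! ### Heyting implication of subobjects -/

section Implication

variable {E : Type u} [Category.{v} E] [HasFiniteLimits E] (Ω : Subobject.Classifier E)

theorem classified_chi_arrow {X : E} (A : Subobject X) : classified Ω (Ω.χ A.arrow) = A := by
  rw [classified_chi, Subobject.mk_arrow]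

theorem chi_classified {X : E} (f : X ⟶ Ω.Ω) : Ω.χ (classified Ω f).arrow = f :=
  Ω.χ_pullback_obj_mk_truth_arrow f

/-- The Heyting implication of subobjects. -/
noncomputable def imp {X : E} (A B : Subobject X) : Subobject X :=
  equalizerSubobject (Ω.χ A.arrow) (Ω.χ (A ⊓ B).arrow)

/-- The Kripke–Joyal clause for implication: at stage `t`, the two classifying maps agree iff the
pullback of `A` equals that of `A ⊓ B`. -/
theorem imp_factors_iff {T X : E} (A B : Subobject X) (t : T ⟶ X) :
    (imp Ω A B).Factors t ↔ ∀ ⦃W : E⦄ (s : W ⟶ T), A.Factors (s ≫ t) → B.Factors (s ≫ t) := by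
  have h : (imp Ω A B).Factors t ↔
      (Subobject.pullback t).obj A ≤ (Subobject.pullback t).obj B := by
    rw [imp, equalizerSubobject_factors_iff, ← inf_eq_left, ← Subobject.inf_pullback]
    conv_rhs => rw [← classified_chi_arrow Ω A, ← classified_chi_arrow Ω (_ ⊓ B),
      ← classified_comp, ← classified_comp]
    rw [classified_chi_arrow Ω A]
    exact ⟨fun h => h ▸ rfl, fun h => (classified_injective Ω h).symm⟩
  rw [h]
  constructor
  · intro h W s hs
    rw [← pullback_factors_iff] at hs ⊢
    exact Subobject.factors_of_le _ h hs
  · intro h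
    rw [le_iff_factors, pullback_factors_iff]
    apply h
    rw [← pullback_factors_iff]
    exact Subobject.factors_self _

end Implication

namespace LocalOperator

/-! ### Closure, closed and dense subobjects -/

section Closure

variable {E : Type u} [Category.{v} E] [HasFiniteLimits E] [CartesianMonoidalCategory E]
  {Ω : Subobject.Classifier E} (j : LocalOperator Ω)

theorem closure_classified {X : E} (f : X ⟶ Ω.Ω) :
    j.closure (classified Ω f) = classified Ω (f ≫ j.hom) := by
  rw [closure, chi_classified]

theorem closure_pullback {X Y : E} (f : X ⟶ Y) (A : Subobject Y) :
    j.closure ((Subobject.pullback f).obj A) = (Subobject.pullback f).obj (j.closure A) := by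
  rw [← classified_chi_arrow Ω A, ← classified_comp, closure_classified, closure_classified,
    ← classified_comp, Category.assoc]

theorem le_closure {X : E} (A : Subobject X) : A ≤ j.closure A := by
  conv_lhs => rw [← classified_chi_arrow Ω A]
  rw [closure, le_classified_iff, ← Category.assoc, (le_classified_iff Ω _ _).1 le_rfl,
    Category.assoc, j.truth_hom]

theorem closure_closure {X : E} (A : Subobject X) : j.closure (j.closure A) = j.closure A := by
  conv_lhs => arg 2; rw [closure]
  rw [closure_classified, Category.assoc, j.hom_hom]
  rfl

theorem closure_inf {X : E} (A B : Subobject X) :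
    j.closure (A ⊓ B) = j.closure A ⊓ j.closure B := by
  rw [← classified_chi_arrow Ω A, ← classified_chi_arrow Ω B, ← classified_and,
    closure_classified, closure_classified, closure_classified, ← classified_and, Category.assoc,
    j.and_hom, lift_map_assoc]

theorem closure_mono {X : E} {A B : Subobject X} (h : A ≤ B) : j.closure A ≤ j.closure B := by
  rw [← inf_eq_left] at h ⊢
  rw [← closure_inf, h]

theorem closure_top (X : E) : j.closure (⊤ : Subobject X) = ⊤ :=
  top_le_iff.1 (j.le_closure _)

/-- A `j`-closed subobject. -/
def IsClosed {X : E} (A : Subobject X) : Prop := j.closure A ≤ A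

variable {j}

theorem IsClosed.closure_eq {X : E} {A : Subobject X} (h : j.IsClosed A) : j.closure A = A :=
  le_antisymm h (j.le_closure A)

theorem isClosed_closure {X : E} (A : Subobject X) : j.IsClosed (j.closure A) :=
  (j.closure_closure A).le

theorem IsClosed.pullback {X Y : E} {A : Subobject Y} (h : j.IsClosed A) (f : X ⟶ Y) :
    j.IsClosed ((Subobject.pullback f).obj A) := by
  rw [IsClosed, closure_pullback, h.closure_eq]

theorem IsClosed.eq_top {X : E} {A B : Subobject X} (h : j.IsClosed B) (hA : j.IsDense A)
    (hAB : A ≤ B) : B = ⊤ :=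
  top_le_iff.1 ((hA.symm.le.trans (j.closure_mono hAB)).trans h)

theorem IsDense.pullback {X Y : E} {A : Subobject Y} (h : j.IsDense A) (f : X ⟶ Y) :
    j.IsDense ((Subobject.pullback f).obj A) := by
  rw [IsDense, closure_pullback, h, Subobject.pullback_top]

theorem isDense_pullback_arrow {X : E} {A B : Subobject X} (h : B ≤ j.closure A) :
    j.IsDense ((Subobject.pullback B.arrow).obj A) := by
  rw [IsDense, closure_pullback, ← factors_iff_pullback_eq_top, ← le_iff_factors]
  exact h

/-- An element of `A` and of the closure of `A ⇒ B` lies in `A ⇒ B`, hence in `B`, on a dense part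
of its domain; since `B` is closed, it lies in `B`. -/
theorem isClosed_imp {X : E} (A : Subobject X) {B : Subobject X} (hB : j.IsClosed B) :
    j.IsClosed (imp Ω A B) := by
  rw [IsClosed, le_iff_factors, imp_factors_iff]
  intro W s hs
  rw [factors_iff_pullback_eq_top]
  refine (hB.pullback _).eq_top (A := (Subobject.pullback (s ≫ (j.closure (imp Ω A B)).arrow)).obj
    (imp Ω A B)) ?_ ?_
  · rw [IsDense, closure_pullback, ← factors_iff_pullback_eq_top]
    exact Subobject.factors_comp_arrow _
  · rw [le_iff_factors, pullback_factors_iff]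
    have h := Subobject.factors_self ((Subobject.pullback (s ≫ (j.closure (imp Ω A B)).arrow)).obj
      (imp Ω A B))
    rw [pullback_factors_iff, imp_factors_iff] at h
    have h' := h (𝟙 _)
    rw [Category.id_comp] at h'
    exact h' (Subobject.factors_of_factors_right _ hs)

end Closure

/-! ### Sheaves, closed subobjects, and the sheaf of closed truth values -/

section Sheaf

variable {E : Type u} [Category.{v} E] [HasFiniteLimits E] [CartesianMonoidalCategory E]
  {Ω : Subobject.Classifier E} {j : LocalOperator Ω}

theorem isSheaf.hom_ext {F Z : E} (hF : j.isSheaf F) {S : Subobject Z} (hS : j.IsDense S)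
    {f g : Z ⟶ F} (h : S.arrow ≫ f = S.arrow ≫ g) : f = g :=
  (hF S.arrow (by rwa [Subobject.mk_arrow]) (S.arrow ≫ g)).unique h rfl

/-- The equalizer is dense in its closure, and maps from that closure into a sheaf are determined on
a dense subobject. -/
theorem isSheaf.isClosed_equalizer {F Z : E} (hF : j.isSheaf F) (f g : Z ⟶ F) :
    j.IsClosed (equalizerSubobject f g) := by
  rw [IsClosed, le_iff_factors, equalizerSubobject_factors_iff]
  refine hF.hom_ext (isDense_pullback_arrow le_rfl) ?_
  have h := Subobject.factors_self ((Subobject.pullback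
    (j.closure (equalizerSubobject f g)).arrow).obj (equalizerSubobject f g))
  rw [pullback_factors_iff, equalizerSubobject_factors_iff] at h
  simpa using h

theorem isSheaf.of_isClosed {F : E} (hF : j.isSheaf F) {A : Subobject F} (hA : j.IsClosed A) :
    j.isSheaf (A : E) := by
  intro X S m _ hm f
  obtain ⟨g, hg, hu⟩ := hF m hm (f ≫ A.arrow)
  have h : A.Factors g := by
    rw [factors_iff_pullback_eq_top]
    refine (hA.pullback g).eq_top hm ?_
    rw [le_iff_factors, pullback_factors_iff, ← Subobject.underlyingIso_hom_comp_eq_mk,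
      Category.assoc, hg, ← Category.assoc]
    exact Subobject.factors_comp_arrow _
  refine ⟨A.factorThru g h, ?_, fun g' hg' => ?_⟩
  · simp only [← cancel_mono A.arrow, Category.assoc, Subobject.factorThru_arrow, hg]
  · rw [← cancel_mono A.arrow, Subobject.factorThru_arrow]
    exact hu _ (by simp only [← Category.assoc, hg'])

/-- Since `A` is dense in its closure, the identity of `A` extends to a map from the closure to `A`,
which is compatible with the inclusions into `F`. -/
theorem isSheaf.isClosed_mk {F A : E} (hF : j.isSheaf F) (hA : j.isSheaf A) (m : A ⟶ F) [Mono m] :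
    j.IsClosed (Subobject.mk m) := by
  have hd := isDense_pullback_arrow (j := j) (le_refl (j.closure (Subobject.mk m)))
  obtain ⟨r, hr, -⟩ := hA (Subobject.arrow _) (by rwa [Subobject.mk_arrow])
    (Subobject.pullbackπ (j.closure (Subobject.mk m)).arrow (Subobject.mk m) ≫
      (Subobject.underlyingIso m).hom)
  refine Subobject.le_mk_of_comm r (hF.hom_ext hd ?_)
  rw [← Category.assoc, hr, Category.assoc, Subobject.underlyingIso_hom_comp_eq_mk,
    (Subobject.isPullback _ _).w]

variable (j)

/-- The object of `j`-closed truth values. -/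
noncomputable def closedTruth : E := equalizer j.hom (𝟙 Ω.Ω)

/-- The inclusion of the `j`-closed truth values into all truth values. -/
noncomputable def closedTruthι : j.closedTruth ⟶ Ω.Ω := equalizer.ι _ _

instance : Mono j.closedTruthι := inferInstanceAs (Mono (equalizer.ι _ _))

theorem closedTruthι_hom : j.closedTruthι ≫ j.hom = j.closedTruthι :=
  (equalizer.condition _ _).trans (Category.comp_id _)

/-- The subobject classified by a family of `j`-closed truth values. -/
noncomputable def closedClassified {X : E} (f : X ⟶ j.closedTruth) : Subobject X :=
  classified Ω (f ≫ j.closedTruthι)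

theorem closedClassified_comp {X Y : E} (g : X ⟶ Y) (f : Y ⟶ j.closedTruth) :
    j.closedClassified (g ≫ f) = (Subobject.pullback g).obj (j.closedClassified f) := by
  rw [closedClassified, Category.assoc, classified_comp]
  rfl

variable {j} in
theorem closedClassified_injective {X : E} {f g : X ⟶ j.closedTruth}
    (h : j.closedClassified f = j.closedClassified g) : f = g :=
  (cancel_mono j.closedTruthι).1 (classified_injective Ω h)

theorem isClosed_closedClassified {X : E} (f : X ⟶ j.closedTruth) :
    j.IsClosed (j.closedClassified f) := by
  rw [IsClosed, closedClassified, closure_classified, Category.assoc, closedTruthι_hom]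

variable {j} in
theorem IsClosed.exists_closedClassified {X : E} {A : Subobject X} (hA : j.IsClosed A) :
    ∃ f, j.closedClassified f = A := by
  have h : Ω.χ A.arrow ≫ j.hom = Ω.χ A.arrow ≫ 𝟙 _ := by
    apply classified_injective
    rw [← closure_classified, Category.comp_id, classified_chi_arrow, hA.closure_eq]
  refine ⟨equalizer.lift _ h, ?_⟩
  have : equalizer.lift _ h ≫ j.closedTruthι = Ω.χ A.arrow := equalizer.lift_ι _ _
  exact (congrArg (classified Ω) this).trans (classified_chi_arrow Ω A)

theorem isSheaf_closedTruth : j.isSheaf j.closedTruth := by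
  intro X A m _ hm f
  -- A closed subobject of `A` extends to the closure of its image in `X`.
  obtain ⟨g, hg⟩ := (isClosed_closure (j := j)
    ((Subobject.map m).obj (j.closedClassified f))).exists_closedClassified
  refine ⟨g, ?_, fun g' hg' => ?_⟩
  · apply closedClassified_injective
    rw [closedClassified_comp, hg, ← closure_pullback, Subobject.pullback_map_self,
      (j.isClosed_closedClassified f).closure_eq]
  -- Uniqueness: a closed subobject of `X` is the closure of its trace on the dense subobject `m`.
  · have key : j.closedClassified g' = j.closure (j.closedClassified g' ⊓ Subobject.mk m) := by
      rw [closure_inf, (show j.closure (Subobject.mk m) = ⊤ from hm), inf_top_eq,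
        (j.isClosed_closedClassified g').closure_eq]
    apply closedClassified_injective
    rw [hg]
    refine Eq.trans key ?_
    rw [inf_comm]
    congr 1
    apply le_antisymm
    · rw [le_iff_factors]
      have h := Subobject.factors_self (Subobject.mk m ⊓ j.closedClassified g')
      rw [inf_factors_iff, mk_factors] at h
      obtain ⟨⟨t, ht⟩, h⟩ := h
      rw [← ht] at h ⊢
      rw [← pullback_factors_iff, Subobject.pullback_map_self, ← hg', closedClassified_comp,
        pullback_factors_iff]
      exact h
    · rw [← hg', closedClassified_comp]
      refine le_inf ?_ (((Subobject.mapPullbackAdj m).gc _ _).2 le_rfl)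
      rw [← Subobject.map_top]
      exact (Subobject.map m).monotone le_top

end Sheaf

/-! ### Covers and densely injective maps -/

section Cover

variable {E : Type u} [Category.{v} E] [HasFiniteLimits E] [CartesianMonoidalCategory E]
  {Ω : Subobject.Classifier E} (j : LocalOperator Ω)

/-- The morphisms whose image is `j`-dense, universally. -/
def IsCover {X Y : E} (h : X ⟶ Y) : Prop :=
  ∀ ⦃Z : E⦄ (g : Z ⟶ Y) (D : Subobject Z), j.IsClosed D →
    (∀ ⦃W : E⦄ (w : W ⟶ Z) (x : W ⟶ X), x ≫ h = w ≫ g → D.Factors w) → D = ⊤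

/-- The morphisms that are injective up to `j`-density: the equalizer of any two morphisms that they
coequalize is `j`-dense. -/
def IsDenselyMono {X Y : E} (h : X ⟶ Y) : Prop :=
  ∀ ⦃Z : E⦄ (u v : Z ⟶ X), u ≫ h = v ≫ h → j.IsDense (equalizerSubobject u v)

variable {j}

/-- Membership in a closed subobject may be tested after lifting two elements along two covers
simultaneously. -/
theorem IsCover.eq_top₂ {X Y X' Y' Z : E} {h : X ⟶ Y} {h' : X' ⟶ Y'} (hh : j.IsCover h)
    (hh' : j.IsCover h') (g : Z ⟶ Y) (g' : Z ⟶ Y') {D : Subobject Z} (hD : j.IsClosed D)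
    (H : ∀ ⦃W : E⦄ (w : W ⟶ Z) (x : W ⟶ X) (x' : W ⟶ X'), x ≫ h = w ≫ g → x' ≫ h' = w ≫ g' →
      D.Factors w) : D = ⊤ := by
  refine hh g D hD fun W w x hx => ?_
  rw [factors_iff_pullback_eq_top]
  refine hh' (w ≫ g') _ (hD.pullback w) fun W' w' x' hx' => ?_
  rw [pullback_factors_iff]
  exact H (w' ≫ w) (w' ≫ x) x' (by simp [hx]) (by simp [hx'])

theorem IsCover.of_comp {X Y Z : E} {f : X ⟶ Y} {g : Y ⟶ Z} (h : j.IsCover (f ≫ g)) :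
    j.IsCover g := fun _ t D hD H =>
  h t D hD fun _ w x hx => H w (x ≫ f) (by simpa using hx)

theorem IsCover.comp_iso {X Y Z : E} {f : X ⟶ Y} (h : j.IsCover f) (e : Y ≅ Z) :
    j.IsCover (f ≫ e.hom) := fun _ t D hD H =>
  h (t ≫ e.inv) D hD fun _ w x hx => H w x (by rw [← Category.assoc, hx]; simp)

theorem IsCover.isDense {X Y : E} {m : X ⟶ Y} [Mono m] (h : j.IsCover m) :
    j.IsDense (Subobject.mk m) :=
  h (𝟙 Y) _ (isClosed_closure _) fun _ w x hx =>
    Subobject.factors_of_le _ (j.le_closure _) ((mk_factors _ _).2 ⟨x, by simpa using hx⟩)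

theorem IsCover.hom_ext {X Y F : E} (hF : j.isSheaf F) {h : X ⟶ Y} (hh : j.IsCover h)
    {f g : Y ⟶ F} (hfg : h ≫ f = h ≫ g) : f = g := by
  have key := hh (𝟙 Y) _ (hF.isClosed_equalizer f g) fun W w x hx => by
    rw [Category.comp_id] at hx
    rw [equalizerSubobject_factors_iff, ← hx, Category.assoc, hfg, Category.assoc]
  rw [eq_top_iff_factors_id, equalizerSubobject_factors_iff] at key
  simpa using key

theorem isSheaf.ihom [MonoidalClosed E] {F : E} (hF : j.isSheaf F) (Y : E) :
    j.isSheaf ((ihom Y).obj F) := by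
  intro X A m _ hm f
  have hmono : Mono (Y ◁ m) := ⟨fun u v h => by
    apply CartesianMonoidalCategory.hom_ext
    · simpa using h =≫ fst _ _
    · rw [← cancel_mono m]
      simpa using h =≫ snd _ _⟩
  -- `Y ◁ m` is the pullback of `m` along the projection, so it is dense too.
  have hd : j.IsDense (Subobject.mk (Y ◁ m)) := by
    have h : Subobject.mk (Y ◁ m) = (Subobject.pullback (snd Y X)).obj (Subobject.mk m) := by
      apply le_antisymm
      · refine Subobject.le_of_factors ?_
        rw [pullback_factors_iff, mk_factors]
        exact ⟨(Subobject.underlyingIso _).hom ≫ snd _ _, by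
          rw [← Subobject.underlyingIso_hom_comp_eq_mk, Category.assoc, Category.assoc,
            whiskerLeft_snd]⟩
      · have h := Subobject.factors_self ((Subobject.pullback (snd Y X)).obj (Subobject.mk m))
        rw [pullback_factors_iff, mk_factors] at h
        obtain ⟨t, ht⟩ := h
        rw [le_iff_factors, mk_factors]
        refine ⟨lift (Subobject.arrow _ ≫ fst _ _) t, ?_⟩
        apply CartesianMonoidalCategory.hom_ext <;> simp [ht]
    rw [h]
    exact IsDense.pullback hm _
  obtain ⟨g, hg, hgu⟩ := hF _ hd (MonoidalClosed.uncurry f)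
  refine ⟨MonoidalClosed.curry g, ?_, fun g' hg' => ?_⟩
  · simp only [← MonoidalClosed.curry_natural_left, hg, MonoidalClosed.curry_uncurry]
  · rw [MonoidalClosed.eq_curry_iff]
    apply hgu
    simp only [← MonoidalClosed.uncurry_natural_left, hg']

variable (j) in
-- A natural choice of the value "true", so that membership in a closed subobject becomes an
-- equation between maps into `closedTruth`.
theorem exists_top_closedClassified :
    ∃ t : ∀ X : E, X ⟶ j.closedTruth, (∀ X, j.closedClassified (t X) = ⊤) ∧
      ∀ ⦃X Y : E⦄ (f : X ⟶ Y), f ≫ t Y = t X := by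
  have h (X : E) : j.IsClosed (⊤ : Subobject X) := le_top
  choose t ht using fun X => (h X).exists_closedClassified
  refine ⟨t, ht, fun X Y f => closedClassified_injective ?_⟩
  rw [closedClassified_comp, ht, ht, Subobject.pullback_top]

end Cover

/-! ### Closed images and the associated sheaf -/

section ClosedImage

variable {E : Type u} [Category.{v} E] [HasFiniteLimits E] [CartesianMonoidalCategory E]
  [MonoidalClosed E] {Ω : Subobject.Classifier E} (j : LocalOperator Ω)

/-- Every morphism factors as a cover followed by a `j`-closed subobject. -/
theorem exists_closedImage {X Y : E} (h : X ⟶ Y) :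
    ∃ (I : Subobject Y) (r : X ⟶ (I : E)), j.IsClosed I ∧ r ≫ I.arrow = h ∧ j.IsCover r := by
  obtain ⟨t, ht, htn⟩ := j.exists_top_closedClassified
  have top_iff {Z : E} (f : Z ⟶ j.closedTruth) : f = t Z ↔ j.closedClassified f = ⊤ :=
    ⟨fun h => h ▸ ht _, fun h => closedClassified_injective (h.trans (ht _).symm)⟩
  let ev : Y ⊗ (ihom Y).obj j.closedTruth ⟶ j.closedTruth := (ihom.ev Y).app _
  -- `K` is the object of closed subobjects of `Y` that contain the image of `h`.
  let K := equalizerSubobject (MonoidalClosed.curry (h ▷ (ihom Y).obj j.closedTruth ≫ ev))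
    (MonoidalClosed.curry (t _))
  let e : (K : E) ⊗ Y ⟶ j.closedTruth := lift (snd _ _) (fst _ _ ≫ K.arrow) ≫ ev
  -- `I` is the internal intersection of the members of `K`.
  let I : Subobject Y := equalizerSubobject (MonoidalClosed.curry e)
    (MonoidalClosed.curry (t ((K : E) ⊗ Y)))
  have hI {Z : E} (g : Z ⟶ Y) : I.Factors g ↔ (K : E) ◁ g ≫ e = t _ := by
    rw [equalizerSubobject_factors_iff, ← MonoidalClosed.curry_natural_left,
      ← MonoidalClosed.curry_natural_left, htn]
    exact MonoidalClosed.curry_injective.eq_iff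
  have hK {Z : E} (k : Z ⟶ (ihom Y).obj j.closedTruth) : K.Factors k ↔ h ▷ Z ≫ Y ◁ k ≫ ev = t _ := by
    rw [equalizerSubobject_factors_iff, ← MonoidalClosed.curry_natural_left,
      ← MonoidalClosed.curry_natural_left, htn, whisker_exchange_assoc]
    exact MonoidalClosed.curry_injective.eq_iff
  have hh : I.Factors h := by
    rw [hI]
    have h1 := (hK K.arrow).1 (Subobject.factors_self K)
    have h2 : (K : E) ◁ h ≫ e = lift (snd _ _) (fst _ _) ≫ h ▷ (K : E) ≫ Y ◁ K.arrow ≫ ev := by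
      simp only [e, ← Category.assoc]
      congr 1
      apply CartesianMonoidalCategory.hom_ext <;> simp
    rw [h2, h1, htn]
  refine ⟨I, I.factorThru h hh, ?_, Subobject.factorThru_arrow _ _ _, ?_⟩
  · exact isSheaf.isClosed_equalizer (isSheaf.ihom j.isSheaf_closedTruth _) _ _
  · intro Z g D hD H
    -- The family `C_z = {y | y = g z ⇒ z ∈ D}` consists of closed subobjects containing the image
    -- of `h`, so it factors through `K`. As `g z` lies in every member of `K`, it lies in `C_z`,
    -- and hence `z ∈ D`.
    let C : Subobject (Y ⊗ Z) := imp Ω (equalizerSubobject (fst Y Z) (snd Y Z ≫ g ≫ I.arrow))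
      ((Subobject.pullback (snd Y Z)).obj D)
    have hC {T : E} (s : T ⟶ Y ⊗ Z) : C.Factors s ↔ ∀ ⦃W : E⦄ (w : W ⟶ T),
        w ≫ s ≫ fst _ _ = w ≫ s ≫ snd _ _ ≫ g ≫ I.arrow → D.Factors (w ≫ s ≫ snd _ _) := by
      simp only [C, imp_factors_iff, equalizerSubobject_factors_iff, pullback_factors_iff,
        Category.assoc]
    obtain ⟨c, hc⟩ := (isClosed_imp (j := j) (equalizerSubobject (fst Y Z) (snd Y Z ≫ g ≫ I.arrow))
      (hD.pullback (snd Y Z))).exists_closedClassified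
    have hcC {T : E} (s : T ⟶ Y ⊗ Z) : s ≫ c = t T ↔ C.Factors s := by
      rw [top_iff, closedClassified_comp, hc, factors_iff_pullback_eq_top]
    have hcu : Y ◁ MonoidalClosed.curry c ≫ ev = c := by
      rw [← MonoidalClosed.uncurry_eq, MonoidalClosed.uncurry_curry]
    have hk : K.Factors (MonoidalClosed.curry c) := by
      rw [hK, hcu, hcC, hC]
      intro W w hw
      simp only [whiskerRight_fst, whiskerRight_snd_assoc, whiskerRight_snd] at hw ⊢
      refine H (w ≫ snd _ _) (w ≫ fst _ _) ?_
      rw [← cancel_mono I.arrow]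
      simpa using hw
    have h1 := lift (K.factorThru _ hk) (𝟙 Z) ≫= (hI (g ≫ I.arrow)).1
      (Subobject.factors_comp_arrow g)
    have h2 : lift (K.factorThru _ hk) (𝟙 Z) ≫ (K : E) ◁ (g ≫ I.arrow) ≫ e =
        lift (g ≫ I.arrow) (𝟙 Z) ≫ c := by
      conv_rhs => rw [← hcu]
      simp only [e, ← Category.assoc]
      congr 1
      apply CartesianMonoidalCategory.hom_ext <;> simp
    rw [h2, htn, hcC, hC] at h1
    rw [eq_top_iff_factors_id]
    simpa using h1 (𝟙 Z) (by simp)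

/-- Sheaves are orthogonal to the covers that are injective up to `j`-density. -/
theorem isSheaf.existsUnique_extension {X Y F : E} (hF : j.isSheaf F) {h : X ⟶ Y}
    (hc : j.IsCover h) (hm : j.IsDenselyMono h) (f : X ⟶ F) : ∃! g : Y ⟶ F, h ≫ g = f := by
  -- The closed image `R` of `(h, f)` is a partial graph of the extension: single-valued because `h`
  -- is densely mono and `F` a sheaf, with dense domain because `h` is a cover.
  obtain ⟨R, r, -, hr, hrc⟩ := j.exists_closedImage (lift h f)
  have hr1 : r ≫ R.arrow ≫ fst _ _ = h := by rw [← Category.assoc, hr, lift_fst]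
  have hr2 : r ≫ R.arrow ≫ snd _ _ = f := by rw [← Category.assoc, hr, lift_snd]
  have hmono : Mono (R.arrow ≫ fst _ _) := by
    refine ⟨fun {Z} u v huv => ?_⟩
    have key : equalizerSubobject (u ≫ R.arrow ≫ snd _ _) (v ≫ R.arrow ≫ snd _ _) = ⊤ := by
      refine hrc.eq_top₂ hrc u v (hF.isClosed_equalizer _ _) fun W w x x' hx hx' => ?_
      rw [equalizerSubobject_factors_iff, ← Category.assoc, ← hx, ← Category.assoc w, ← hx',
        Category.assoc, Category.assoc, hr2]
      refine hF.hom_ext (hm x x' ?_) ?_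
      · rw [← hr1, ← Category.assoc, hx, Category.assoc, huv, ← Category.assoc, ← hx',
          Category.assoc]
      · rw [← Category.assoc, ← Category.assoc, (equalizerSubobject_factors_iff x x' _).1
          (Subobject.factors_self _)]
    rw [eq_top_iff_factors_id, equalizerSubobject_factors_iff, Category.id_comp,
      Category.id_comp] at key
    rw [← cancel_mono R.arrow]
    apply CartesianMonoidalCategory.hom_ext
    · simpa using huv
    · simpa using key
  have hd : j.IsDense (Subobject.mk (R.arrow ≫ fst Y F)) :=
    (IsCover.of_comp (f := r) (by rwa [hr1])).isDense
  obtain ⟨g, hg, -⟩ := hF _ hd (R.arrow ≫ snd _ _)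
  have hg' : h ≫ g = f := by rw [← hr1, Category.assoc, hg, hr2]
  exact ⟨g, hg', fun g' h' => hc.hom_ext hF (h'.trans hg'.symm)⟩

/-- Every object has a densely injective cover of a sheaf: the closed image of the morphism that
sends an element to the closure of its singleton. -/
theorem exists_associatedSheaf (X : E) :
    ∃ (F : E) (h : X ⟶ F), j.isSheaf F ∧ j.IsCover h ∧ j.IsDenselyMono h := by
  -- `d` classifies the closure of the diagonal; its transpose sends `x` to the closure of `{x}`.
  obtain ⟨d, hd⟩ := (isClosed_closure (j := j)
    (equalizerSubobject (fst X X) (snd X X))).exists_closedClassified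
  obtain ⟨I, r, hI, hr, hrc⟩ := j.exists_closedImage (MonoidalClosed.curry d)
  refine ⟨I, r, isSheaf.of_isClosed (isSheaf.ihom j.isSheaf_closedTruth X) hI, hrc,
    fun Z u v huv => ?_⟩
  have h1 : X ◁ u ≫ d = X ◁ v ≫ d := by
    apply MonoidalClosed.curry_injective
    rw [MonoidalClosed.curry_natural_left, MonoidalClosed.curry_natural_left, ← hr,
      ← Category.assoc, huv, Category.assoc]
  -- If `u` and `v` have equal closed singletons, then `u`, lying in its own, lies in that of `v`.
  have h2 : lift u u ≫ d = lift u v ≫ d := by simpa using lift u (𝟙 Z) ≫= h1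
  have h3 := congrArg j.closedClassified h2
  rw [closedClassified_comp, closedClassified_comp, hd, ← closure_pullback, ← closure_pullback] at h3
  have h4 : (Subobject.pullback (lift u u)).obj (equalizerSubobject (fst X X) (snd X X)) = ⊤ := by
    rw [← factors_iff_pullback_eq_top, equalizerSubobject_factors_iff]
    simp
  have h5 : (Subobject.pullback (lift u v)).obj (equalizerSubobject (fst X X) (snd X X)) ≤
      equalizerSubobject u v := by
    rw [le_iff_factors, equalizerSubobject_factors_iff]
    have h := Subobject.factors_self ((Subobject.pullback (lift u v)).obj
      (equalizerSubobject (fst X X) (snd X X)))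
    rw [pullback_factors_iff, equalizerSubobject_factors_iff] at h
    simpa using h
  rw [h4, closure_top] at h3
  exact top_le_iff.1 (h3.le.trans (j.closure_mono h5))

theorem isRightAdjoint_inclusion : j.inclusion.IsRightAdjoint := by
  choose F h hF hc hm using j.exists_associatedSheaf
  have ex {X : E} {G : j.Sh} (f : X ⟶ G.obj) :=
    isSheaf.existsUnique_extension j G.property (hc X) (hm X) f
  exact (Adjunction.adjunctionOfEquivLeft (G := j.inclusion) (F_obj := fun X => ⟨F X, hF X⟩)
    (fun X G =>
      { toFun := fun g => h X ≫ g.hom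
        invFun := fun f => ObjectProperty.homMk (ex f).choose
        left_inv := fun g => by
          ext
          exact ((ex (h X ≫ g.hom)).choose_spec.2 g.hom rfl).symm
        right_inv := fun f => (ex f).choose_spec.1 })
    (fun X G G' f g => by simp)).isRightAdjoint

variable {j}

/-- Any unit is isomorphic to the densely injective cover `h` already constructed: `g` and `k` are
the comparison maps given by the two universal properties. -/
theorem isCover_and_isDenselyMono_unit {a : E ⥤ j.Sh} (adj : a ⊣ j.inclusion) (X : E) :
    j.IsCover (adj.unit.app X) ∧ j.IsDenselyMono (adj.unit.app X) := by
  obtain ⟨F, h, hF, hc, hm⟩ := j.exists_associatedSheaf X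
  obtain ⟨g, hg, -⟩ := isSheaf.existsUnique_extension j (a.obj X).property hc hm (adj.unit.app X)
  let k : a.obj X ⟶ ⟨F, hF⟩ := (adj.homEquiv X ⟨F, hF⟩).symm h
  have hk : adj.unit.app X ≫ k.hom = h := by
    have := (adj.homEquiv X ⟨F, hF⟩).apply_symm_apply h
    rwa [adj.homEquiv_unit] at this
  have h1 : g ≫ k.hom = 𝟙 F := hc.hom_ext hF (by rw [← Category.assoc, hg, hk, Category.comp_id])
  have h2 : k ≫ ObjectProperty.homMk g = 𝟙 (a.obj X) := by
    apply (adj.homEquiv X _).injective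
    rw [adj.homEquiv_unit, adj.homEquiv_unit, Functor.map_comp, CategoryTheory.Functor.map_id,
      ← Category.assoc]
    exact (congrArg (· ≫ g) hk).trans (hg.trans (Category.comp_id _).symm)
  have h3 : k.hom ≫ g = 𝟙 _ := congrArg (fun t => t.hom) h2
  refine ⟨?_, fun Z u v huv => hm u v ?_⟩
  · rw [← hg]
    exact hc.comp_iso ⟨g, k.hom, h1, h3⟩
  · rw [← hk, ← Category.assoc, huv, Category.assoc]

end ClosedImage

end LocalOperator

end Topos

/-! ### Negation and the associated sheaf functor -/

namespace Topos

variable {E : Type u} [Category.{v} E] [HasFiniteLimits E] [CartesianMonoidalCategory E]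
  [MonoidalClosed E] {Ω : Subobject.Classifier E}

theorem pullback_neg {X Y : E} (f : X ⟶ Y) (A : Subobject Y) :
    (Subobject.pullback f).obj (neg Ω A) = neg Ω ((Subobject.pullback f).obj A) := by
  rw [← classified_chi_arrow Ω A, neg_classified, ← classified_comp, ← classified_comp,
    neg_classified, Category.assoc]

theorem isBot_of_factors_neg {X Y : E} {A : Subobject Y} {s : X ⟶ Y} (h : A.Factors s)
    (h' : (neg Ω A).Factors s) : IsBot (⊤ : Subobject X) := by
  rw [factors_iff_pullback_eq_top] at h h'
  rw [pullback_neg, h] at h'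
  exact (le_neg_iff Ω _ _).1 h'.ge ⊤ le_rfl le_rfl

omit [CartesianMonoidalCategory E] [MonoidalClosed E] in
theorem factors_of_isBot {X Y : E} (h : IsBot (⊤ : Subobject X)) (f : X ⟶ Y) (B : Subobject Y) :
    B.Factors f := by
  rw [factors_iff_pullback_eq_top]
  exact top_le_iff.1 (h _)

omit [CartesianMonoidalCategory E] [MonoidalClosed E] in
theorem isBot_of_isBot_top {Y : E} {A : Subobject Y} (h : IsBot (⊤ : Subobject (A : E))) :
    IsBot A := fun B => (le_iff_factors _ _).2 (factors_of_isBot h _ B)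

namespace LocalOperator

variable {j : LocalOperator Ω}

/-- Pull the inequality `j ≤ ¬¬` between subobjects of `Ω` back along the classifying map of `A`. -/
theorem closure_le_neg_neg (hj : j ≤ notNot Ω) {X : E} (A : Subobject X) :
    j.closure A ≤ neg Ω (neg Ω A) := by
  have h : classified Ω j.hom ≤ classified Ω (not Ω ≫ not Ω) := hj
  have h' := (Subobject.pullback (Ω.χ A.arrow)).monotone h
  rw [← classified_comp, ← classified_comp, ← Category.assoc, ← neg_classified,
    ← neg_classified, classified_chi_arrow] at h'
  exact h'

theorem isClosed_neg (hj : j ≤ notNot Ω) {X : E} (A : Subobject X) : j.IsClosed (neg Ω A) :=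
  (closure_le_neg_neg hj _).trans (neg_neg_neg Ω A).le

/-- Objects covered by disjoint parts `n` and `A` of `X` are disjoint over `H`. -/
theorem isBot_top_of_covers (hj : j ≤ notNot Ω) {X A D F G H : E} {n : Subobject X}
    {m : A ⟶ X} (hm : (neg Ω n).Factors m) {h : (n : E) ⟶ F} {k : A ⟶ G} {l : X ⟶ H}
    (hh : j.IsCover h) (hk : j.IsCover k) (hl : j.IsDenselyMono l) {f : F ⟶ H} {g : G ⟶ H}
    (hf : h ≫ f = n.arrow ≫ l) (hg : k ≫ g = m ≫ l) (u : D ⟶ F) (v : D ⟶ G)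
    (huv : u ≫ f = v ≫ g) : IsBot (⊤ : Subobject D) := by
  -- Emptiness of `D` is phrased through the closed subobject `¬⊤`, so that it can be tested on
  -- covers and on dense subobjects.
  suffices h : neg Ω (⊤ : Subobject D) = ⊤ from
    (le_neg_iff Ω _ _).1 h.ge ⊤ le_rfl le_rfl
  refine hh.eq_top₂ hk u v (isClosed_neg hj _) fun W w x x' hx hx' => ?_
  have hd := hl (x ≫ n.arrow) (x' ≫ m) (by
    rw [Category.assoc, ← hf, ← Category.assoc, hx, Category.assoc, huv, ← Category.assoc, ← hx',
      Category.assoc, hg, Category.assoc])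
  rw [factors_iff_pullback_eq_top]
  -- On the dense part where the two lifts agree in `X`, their common value lies in both `n` and
  -- `¬n`.
  refine ((isClosed_neg hj _).pullback w).eq_top hd (isBot_of_isBot_top ?_ _)
  have h1 := (equalizerSubobject_factors_iff _ _ _).1
    (Subobject.factors_self (equalizerSubobject (x ≫ n.arrow) (x' ≫ m)))
  refine isBot_of_factors_neg (Ω := Ω) (A := n)
    (s := (equalizerSubobject (x ≫ n.arrow) (x' ≫ m)).arrow ≫ x ≫ n.arrow) ?_ ?_
  · rw [← Category.assoc]
    exact Subobject.factors_comp_arrow _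
  · rw [h1, ← Category.assoc]
    exact Subobject.factors_of_factors_right _ hm

/-- If `a(m)` identifies `u` and `v`, their local lifts `x`, `x'` satisfy `x ≫ m = x' ≫ m` densely.
Hence `x = x'` densely, and `u = v` because `a(A)` is a sheaf. -/
theorem preservesMonomorphisms {a : E ⥤ j.Sh} (adj : a ⊣ j.inclusion) :
    a.PreservesMonomorphisms where
  preserves {A X} m _ := by
    refine ⟨fun {Z} u v huv => ?_⟩
    obtain ⟨hA, -⟩ := isCover_and_isDenselyMono_unit adj A
    obtain ⟨-, hX⟩ := isCover_and_isDenselyMono_unit adj X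
    have huv' : u.hom ≫ (a.map m).hom = v.hom ≫ (a.map m).hom := congrArg (fun t => t.hom) huv
    have hn : adj.unit.app A ≫ (a.map m).hom = m ≫ adj.unit.app X := (adj.unit.naturality m).symm
    have key := hA.eq_top₂ hA u.hom v.hom (isSheaf.isClosed_equalizer (a.obj A).property u.hom v.hom)
      fun W w x x' hx hx' => by
        have hd := hX (x ≫ m) (x' ≫ m) (by
          rw [Category.assoc, Category.assoc, ← hn, ← Category.assoc, hx, ← Category.assoc, hx',
            Category.assoc, huv', Category.assoc])
        rw [equalizerSubobject_factors_iff, ← hx, ← hx']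
        have h1 := (equalizerSubobject_factors_iff (x ≫ m) (x' ≫ m) _).1 (Subobject.factors_self _)
        simp only [← Category.assoc, cancel_mono] at h1
        refine isSheaf.hom_ext (a.obj A).property hd ?_
        rw [← Category.assoc]
        exact (congrArg (· ≫ adj.unit.app A) h1).trans (Category.assoc _ _ _)
    rw [eq_top_iff_factors_id, equalizerSubobject_factors_iff, Category.id_comp,
      Category.id_comp] at key
    ext
    exact key

instance mono_hom {X Y : j.Sh} (m : Y ⟶ X) [Mono m] : Mono m.hom :=
  have := j.isRightAdjoint_inclusion
  inferInstanceAs (Mono (j.inclusion.map m))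

/-- A subobject in `sh_j(E)`, regarded as a subobject in `E`. -/
noncomputable def subobjectι {X : j.Sh} (A : Subobject X) : Subobject X.obj :=
  Subobject.mk A.arrow.hom

theorem subobjectι_mk {X Y : j.Sh} (m : Y ⟶ X) [Mono m] :
    subobjectι (Subobject.mk m) = Subobject.mk m.hom := by
  have h1 : (Subobject.underlyingIso m).hom.hom ≫ m.hom = (Subobject.mk m).arrow.hom :=
    congrArg (fun t => t.hom) (Subobject.underlyingIso_hom_comp_eq_mk m)
  have h2 : (Subobject.underlyingIso m).inv.hom ≫ (Subobject.mk m).arrow.hom = m.hom :=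
    congrArg (fun t => t.hom) (Subobject.underlyingIso_arrow m)
  exact le_antisymm (Subobject.mk_le_mk_of_comm _ h1) (Subobject.mk_le_mk_of_comm _ h2)

theorem subobjectι_le_iff {X : j.Sh} {A B : Subobject X} :
    subobjectι A ≤ subobjectι B ↔ A ≤ B := by
  constructor
  · intro h
    have h' := Subobject.factors_of_le _ h (Subobject.mk_factors_self A.arrow.hom)
    obtain ⟨t, ht⟩ := (mk_factors _ _).1 h'
    refine Subobject.le_of_comm (ObjectProperty.homMk t) ?_
    ext
    exact ht
  · intro h
    exact Subobject.mk_le_mk_of_comm (Subobject.ofLE _ _ h).hom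
      (congrArg (fun t => t.hom) (Subobject.ofLE_arrow h))

theorem isClosed_subobjectι {X : j.Sh} (A : Subobject X) : j.IsClosed (subobjectι A) :=
  isSheaf.isClosed_mk X.property (A : j.Sh).property A.arrow.hom

theorem subobjectι_subobjectSh {X : j.Sh} (A : Subobject X.obj) (hA : j.isSheaf (A : E)) :
    subobjectι (j.subobjectSh A hA) = A :=
  (subobjectι_mk (ObjectProperty.homMk A.arrow : (⟨(A : E), hA⟩ : j.Sh) ⟶ X)).trans
    (Subobject.mk_arrow A)

/-- The empty subobject `¬⊤` is closed, hence a sheaf, so the least subobject in `sh_j(E)` lies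
below it. -/
theorem isBot_subobjectι_iff (hj : j ≤ notNot Ω) {X : j.Sh} {A : Subobject X} :
    IsBot (subobjectι A) ↔ IsBot A := by
  refine ⟨fun h B => subobjectι_le_iff.1 (h _), fun h => ?_⟩
  have h0 : IsBot (neg Ω (⊤ : Subobject X.obj)) := fun B =>
    (le_neg_iff Ω _ _).1 le_rfl _ le_rfl le_top B
  have h1 := subobjectι_le_iff.2 (h (j.subobjectSh (neg Ω (⊤ : Subobject X.obj))
    (isSheaf.of_isClosed X.property (isClosed_neg hj _))))
  rw [subobjectι_subobjectSh] at h1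
  exact fun B => h1.trans (h0 B)

theorem isPseudocomplement_of_subobjectι_eq_neg (hj : j ≤ notNot Ω) {X : j.Sh} {A N : Subobject X}
    (h : subobjectι N = neg Ω (subobjectι A)) : IsPseudocomplement A N := by
  refine ⟨fun D hN hA => ?_, fun C hC => ?_⟩
  · rw [← subobjectι_le_iff] at hN hA
    rw [← isBot_subobjectι_iff hj]
    exact (le_neg_iff Ω _ _).1 (hN.trans h.le) _ le_rfl hA
  · rw [← subobjectι_le_iff, h, le_neg_iff]
    intro D hDC hDA
    -- Disjointness in `sh_j(E)` only speaks of subobjects that are sheaves; `D` is replaced by its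
    -- closure, which stays below the closed subobjects `C` and `A`.
    have hD : j.isSheaf (j.closure D : E) :=
      isSheaf.of_isClosed X.property (isClosed_closure D)
    have h1 := hC (j.subobjectSh _ hD)
    rw [← subobjectι_le_iff, ← subobjectι_le_iff, ← isBot_subobjectι_iff hj,
      subobjectι_subobjectSh] at h1
    exact fun B => (j.le_closure D).trans (h1 ((j.closure_mono hDC).trans (isClosed_subobjectι C))
      ((j.closure_mono hDA).trans (isClosed_subobjectι A)) B)

theorem subobjectι_mapSubobject_neg (hj : j ≤ notNot Ω) {a : E ⥤ j.Sh} (adj : a ⊣ j.inclusion)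
    [a.PreservesMonomorphisms] {X : E} (A : Subobject X) :
    subobjectι (a.mapSubobject (neg Ω A)) = neg Ω (subobjectι (a.mapSubobject A)) := by
  have hu (B : Subobject X) : adj.unit.app (B : E) ≫ (a.map B.arrow).hom =
      B.arrow ≫ adj.unit.app X := (adj.unit.naturality B.arrow).symm
  have hι (B : Subobject X) : subobjectι (a.mapSubobject B) = Subobject.mk (a.map B.arrow).hom :=
    subobjectι_mk _
  have hη (B : Subobject X) {W : E} {x : W ⟶ X} (hx : B.Factors x) :
      (subobjectι (a.mapSubobject B)).Factors (x ≫ adj.unit.app X) := by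
    rw [hι, mk_factors]
    exact ⟨B.factorThru x hx ≫ adj.unit.app (B : E), by
      rw [Category.assoc, hu, ← Category.assoc, Subobject.factorThru_arrow]⟩
  obtain ⟨hXc, hXm⟩ := isCover_and_isDenselyMono_unit adj X
  apply le_antisymm
  · rw [le_neg_iff]
    intro D hN hA
    rw [hι, le_iff_factors, mk_factors] at hN hA
    obtain ⟨v, hv⟩ := hN
    obtain ⟨u, hu'⟩ := hA
    exact isBot_of_isBot_top (isBot_top_of_covers hj (Subobject.factors_self (neg Ω A))
      (isCover_and_isDenselyMono_unit adj _).1 (isCover_and_isDenselyMono_unit adj _).1 hXm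
      (hu A) (hu (neg Ω A)) u v (hu'.trans hv.symm))
  · have hc := (isClosed_subobjectι (a.mapSubobject (neg Ω A))).pullback
      (neg Ω (subobjectι (a.mapSubobject A))).arrow
    rw [le_iff_factors, factors_iff_pullback_eq_top]
    -- An element of `¬a(A)` is locally the image of some `x` in `X`. Wherever `x` lies in `A`, its
    -- image lies in `a(A)` and in `¬a(A)`, so `x` belongs to `¬A`.
    refine hXc (neg Ω (subobjectι (a.mapSubobject A))).arrow _ hc fun W w x hx => ?_
    rw [pullback_factors_iff, ← hx]
    apply hη
    rw [factors_iff_pullback_eq_top, pullback_neg, ← top_le_iff, le_neg_iff]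
    intro D _ hD
    rw [le_iff_factors, pullback_factors_iff] at hD
    refine isBot_of_isBot_top (isBot_of_factors_neg (Ω := Ω) (hη A hD) ?_)
    rw [Category.assoc, hx, ← Category.assoc]
    exact Subobject.factors_comp_arrow _

end LocalOperator

end Topos

theorem proposition6p3 {E : Type u} [Category.{v} E] [HasFiniteLimits E]
    [CartesianMonoidalCategory E] [MonoidalClosed E] (Ω : Subobject.Classifier E)
    (j : Topos.LocalOperator Ω) (hj : j ≤ Topos.LocalOperator.notNot Ω) :
    -- the associated sheaf functor exists,
    j.inclusion.IsRightAdjoint ∧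
    -- it preserves monomorphisms and pseudocomplements of subobjects,
    (∀ (a : E ⥤ j.Sh) (_ : a ⊣ j.inclusion),
      ∃ _ : a.PreservesMonomorphisms, ∀ (X : E) (A : Subobject X),
        IsPseudocomplement (a.mapSubobject A) (a.mapSubobject (Topos.neg Ω A))) ∧
    -- and the pseudocomplement in `sh_j(E)` of a subobject that lies in `sh_j(E)` is that in `E`
    (∀ (X : j.Sh) (A : Subobject X.obj) (hA : j.isSheaf (A : E)),
      ∃ hN : j.isSheaf (Topos.neg Ω A : E),
        IsPseudocomplement (j.subobjectSh A hA) (j.subobjectSh (Topos.neg Ω A) hN)) := by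
  refine ⟨j.isRightAdjoint_inclusion, fun a adj => ?_, fun X A hA => ?_⟩
  · have := Topos.LocalOperator.preservesMonomorphisms adj
    exact ⟨this, fun X A => Topos.LocalOperator.isPseudocomplement_of_subobjectι_eq_neg hj
      (Topos.LocalOperator.subobjectι_mapSubobject_neg hj adj A)⟩
  · refine ⟨Topos.LocalOperator.isSheaf.of_isClosed X.property
      (Topos.LocalOperator.isClosed_neg hj A),
      Topos.LocalOperator.isPseudocomplement_of_subobjectι_eq_neg hj ?_⟩
    rw [Topos.LocalOperator.subobjectι_subobjectSh, Topos.LocalOperator.subobjectι_subobjectSh]
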